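/- Equivalence of $\mathbf{HL}$ and $\mathbf{PDBL}$. \emph{Algebras.} A double Boolean algebra (dBa) is an algebra $(D;\sqcap,\sqcup,\neg,\lrcorner,\top,\bot)$ of type $(2,2,1,1,0,0)$ such that, with $x\vee y:=\neg(\neg x\sqcap\neg y)$ and $x\wedge y:=\lrcorner(\lrcorner x\sqcup\lrcorner y)$, for all $x,y,z\in D$: $(x\sqcap x)\sqcap y=x\sqcap y$, $x\sqcap y=y\sqcap x$, $\neg(x\sqcap x)=\neg x$, $x\sqcap(x\sqcup y)=x\sqcap x$, $x\sqcap(y\vee z)=(x\sqcap y)\vee(x\sqcap z)$, $x\sqcap(x\vee y)=x\sqcap x$, $\neg\neg(x\sqcap y)=x\sqcap y$, $x\sqcap\neg x=\bot$, $\neg\top=\bot$, $x\sqcap(y\sqcap z)=(x\sqcap y)\sqcap z$, $\neg\bot=\top\sqcap\top$, the duals of these equations (interchange $\sqcap,\sqcup$; $\neg,\lrcorner$; $\vee,\wedge$; $\top,\bot$), and $(x\sqcap x)\sqcup(x\sqcap x)=(x\sqcup x)\sqcap(x\sqcup x)$. It is pure if for every $x$, $x\sqcap x=x$ or $x\sqcup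 x=x$. Write $x\sqsubseteq y$ iff $x\sqcap y=x\sqcap x$ and $x\sqcup y=y\sqcup y$. \emph{Syntax.} Formulas are built from countably infinitely many object variables $p$ and countably infinitely many property variables $P$ with $\top,\bot,\neg,\lrcorner,\sqcap,\sqcup$; the connectives $\vee,\wedge$ are the same abbreviations as above. A sequent is an expression $\varphi\Rightarrow\psi$, and a hypersequent is a finite sequence $\varphi_1\Rightarrow\psi_1\mid\dots\mid\varphi_n\Rightarrow\psi_n$. An axiom $\varphi\Leftrightarrow\psi$ stands for $\varphi\Rightarrow\psi$ and $\psi\Rightarrow\varphi$. \emph{Axioms of $\mathbf{L}$:} $\varphi\Rightarrow\varphi$; $\varphi\sqcap\psi\Rightarrow\varphi$; $\varphi\sqcap\psi\Rightarrow\psi$; $\varphi\Rightarrow\varphi\sqcup\psi$; $\psi\Rightarrow\varphi\sqcup\psi$; $\neg(\varphi\sqcap\varphi)\Rightarrow\neg\varphi$; $\lrcorner\varphi\Rightarrow\lrcorner(\varphi\sqcup\varphi)$; $\varphi\sqcap\neg\varphi\Leftrightarrow\bot$; $\top\Leftrightarrow\varphi\sqcup\lrcorner\varphi$; $\neg\neg(\varphi\sqcap\psi)\Leftrightarrow\varphi\sqcap\psi$;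 $\lrcorner\lrcorner(\varphi\sqcup\psi)\Leftrightarrow\varphi\sqcup\psi$; $\varphi\sqcap\varphi\Rightarrow\varphi\sqcap(\varphi\sqcup\psi)$; $\varphi\sqcup(\varphi\sqcap\psi)\Rightarrow\varphi\sqcup\varphi$; $\varphi\sqcap(\psi\vee\theta)\Leftrightarrow(\varphi\sqcap\psi)\vee(\varphi\sqcap\theta)$; $\varphi\sqcup(\psi\wedge\theta)\Leftrightarrow(\varphi\sqcup\psi)\wedge(\varphi\sqcup\theta)$; $(\varphi\sqcup\varphi)\sqcap(\varphi\sqcup\varphi)\Leftrightarrow(\varphi\sqcap\varphi)\sqcup(\varphi\sqcap\varphi)$. \emph{Axioms of $\mathbf{CDBL}$:} those of $\mathbf{L}$ together with $\varphi\sqcap\psi\Rightarrow(\varphi\sqcap\psi)\sqcap(\varphi\sqcap\psi)$; $(\varphi\sqcup\psi)\sqcup(\varphi\sqcup\psi)\Rightarrow\varphi\sqcup\psi$; $\varphi\sqcap\varphi\Rightarrow\varphi\sqcap(\varphi\vee\psi)$; $\varphi\sqcup(\varphi\wedge\psi)\Rightarrow\varphi\sqcup\varphi$; $\bot\Rightarrow\varphi$;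 $\varphi\Rightarrow\top$; $\neg\top\Rightarrow\bot$; $\top\Rightarrow\lrcorner\bot$; $\neg\bot\Leftrightarrow\top\sqcap\top$; $\lrcorner\top\Leftrightarrow\bot\sqcup\bot$. \emph{Calculi.} The axioms of $\mathbf{PDBL}$ are those of $\mathbf{CDBL}$ together with $p\sqcap p\Leftrightarrow p$ for object variables $p$ and $P\sqcup P\Leftrightarrow P$ for property variables $P$. Its rules are the following, where the side hypersequents $B,C,\dots,H,X$ may be empty. From $B\mid\varphi\Rightarrow\psi\mid C$ infer $B\mid\varphi\sqcap\theta\Rightarrow\psi\sqcap\theta\mid C$, $B\mid\theta\sqcap\varphi\Rightarrow\theta\sqcap\psi\mid C$, $B\mid\varphi\sqcup\theta\Rightarrow\psi\sqcup\theta\mid C$, $B\mid\theta\sqcup\varphi\Rightarrow\theta\sqcup\psi\mid C$, $B\mid\neg\psi\Rightarrow\neg\varphi\mid C$, and $B\mid\lrcorner\psi\Rightarrow\lrcorner\varphi\mid C$. (Cut): from $B\mid\varphi\Rightarrow\psi\mid C$ and $D\mid\psi\Rightarrow\theta\mid E$ infer $B\mid D\mid\varphi\Rightarrow\theta\mid C\mid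 E$. (Sp): infer $\varphi\Rightarrow\varphi\sqcap\varphi\mid\varphi\sqcup\varphi\Rightarrow\varphi$ from no premises. ($\sqsubseteq$): from $B\mid\varphi\sqcap\psi\Rightarrow\varphi\sqcap\varphi\mid C$, $D\mid\varphi\sqcap\varphi\Rightarrow\varphi\sqcap\psi\mid E$, $F\mid\varphi\sqcup\psi\Rightarrow\psi\sqcup\psi\mid G$ and $H\mid\psi\sqcup\psi\Rightarrow\varphi\sqcup\psi\mid X$ infer $B\mid D\mid F\mid H\mid\varphi\Rightarrow\psi\mid C\mid E\mid G\mid X$. (EC): from $B\mid D\mid D\mid C$ infer $B\mid D\mid C$. (EE): from $B\mid D\mid E\mid C$ infer $B\mid E\mid D\mid C$. (EW): from $B$ infer $B\mid C$. The calculus $\mathbf{HL}$ is $\mathbf{PDBL}$ with the axioms of $\mathbf{L}$ in place of those of $\mathbf{CDBL}$ (the variable axioms and all rules are kept). \emph{Semantics.} An interpretation in a dBa $\mathbf D$ is a homomorphism $h$ from the algebra of formulas to $\mathbf D$ such that $h(p)\sqcap h(p)=h(p)$ for every object variable $p$ and $h(P)\sqcup h(P)=h(P)$ for every property variable $P$.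 It satisfies a hypersequent if $h(\varphi_i)\sqsubseteq h(\psi_i)$ for at least one component $\varphi_i\Rightarrow\psi_i$. A hypersequent is valid in the class of pure dBas if every interpretation in every pure dBa satisfies it. \textbf{Theorem.} A hypersequent is derivable in $\mathbf{HL}$ if and only if it is derivable in $\mathbf{PDBL}$. Moreover $\mathbf{HL}$ is sound and complete with respect to pure dBas: every hypersequent derivable in $\mathbf{HL}$ is valid in the class of pure dBas, and every hypersequent valid in the class of pure dBas is derivable in $\mathbf{HL}$. -/

import Mathlib

universe u

namespace PureDBL

/-! ### Double Boolean algebras -/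

/-- The signature `(⊓, ⊔, ¬, ⌟, ⊤, ⊥)` of type `(2,2,1,1,0,0)`. -/
class DBAOps (D : Type u) where
  meet : D → D → D
  join : D → D → D
  neg : D → D
  opp : D → D
  top : D
  bot : D

infixl:70 " ⊓ᵈ " => DBAOps.meet
infixl:70 " ⊔ᵈ " => DBAOps.join
prefix:80 "¬ᵈ" => DBAOps.neg
prefix:80 "⌟ᵈ" => DBAOps.opp
notation "⊤ᵈ" => DBAOps.top
notation "⊥ᵈ" => DBAOps.bot

/-- `x ∨ y := ¬(¬x ⊓ ¬y)`. -/
def vee {D : Type u} [DBAOps D] (x y : D) : D := ¬ᵈ(¬ᵈx ⊓ᵈ ¬ᵈy)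

/-- `x ∧ y := ⌟(⌟x ⊔ ⌟y)`. -/
def wedge {D : Type u} [DBAOps D] (x y : D) : D := ⌟ᵈ(⌟ᵈx ⊔ᵈ ⌟ᵈy)

infixl:70 " ∨ᵈ " => vee
infixl:70 " ∧ᵈ " => wedge

/-- Double Boolean algebras (dBas). -/
class DBA (D : Type u) extends DBAOps D where
  meet_idem_left : ∀ x y : D, (x ⊓ᵈ x) ⊓ᵈ y = x ⊓ᵈ y
  join_idem_left : ∀ x y : D, (x ⊔ᵈ x) ⊔ᵈ y = x ⊔ᵈ y
  meet_comm : ∀ x y : D, x ⊓ᵈ y = y ⊓ᵈ x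
  join_comm : ∀ x y : D, x ⊔ᵈ y = y ⊔ᵈ x
  neg_meet_self : ∀ x : D, ¬ᵈ(x ⊓ᵈ x) = ¬ᵈx
  opp_join_self : ∀ x : D, ⌟ᵈ(x ⊔ᵈ x) = ⌟ᵈx
  meet_join_absorb : ∀ x y : D, x ⊓ᵈ (x ⊔ᵈ y) = x ⊓ᵈ x
  join_meet_absorb : ∀ x y : D, x ⊔ᵈ (x ⊓ᵈ y) = x ⊔ᵈ x
  meet_vee_distrib : ∀ x y z : D, x ⊓ᵈ (y ∨ᵈ z) = (x ⊓ᵈ y) ∨ᵈ (x ⊓ᵈ z)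
  join_wedge_distrib : ∀ x y z : D, x ⊔ᵈ (y ∧ᵈ z) = (x ⊔ᵈ y) ∧ᵈ (x ⊔ᵈ z)
  meet_vee_absorb : ∀ x y : D, x ⊓ᵈ (x ∨ᵈ y) = x ⊓ᵈ x
  join_wedge_absorb : ∀ x y : D, x ⊔ᵈ (x ∧ᵈ y) = x ⊔ᵈ x
  neg_neg_meet : ∀ x y : D, ¬ᵈ(¬ᵈ(x ⊓ᵈ y)) = x ⊓ᵈ y
  opp_opp_join : ∀ x y : D, ⌟ᵈ(⌟ᵈ(x ⊔ᵈ y)) = x ⊔ᵈ y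
  meet_neg : ∀ x : D, x ⊓ᵈ ¬ᵈx = ⊥ᵈ
  join_opp : ∀ x : D, x ⊔ᵈ ⌟ᵈx = ⊤ᵈ
  neg_top : ¬ᵈ(⊤ᵈ : D) = ⊥ᵈ
  opp_bot : ⌟ᵈ(⊥ᵈ : D) = ⊤ᵈ
  meet_assoc : ∀ x y z : D, x ⊓ᵈ (y ⊓ᵈ z) = (x ⊓ᵈ y) ⊓ᵈ z
  join_assoc : ∀ x y z : D, x ⊔ᵈ (y ⊔ᵈ z) = (x ⊔ᵈ y) ⊔ᵈ z
  neg_bot : ¬ᵈ(⊥ᵈ : D) = ⊤ᵈ ⊓ᵈ ⊤ᵈ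
  opp_top : ⌟ᵈ(⊤ᵈ : D) = ⊥ᵈ ⊔ᵈ ⊥ᵈ
  meet_join_meet : ∀ x : D, (x ⊓ᵈ x) ⊔ᵈ (x ⊓ᵈ x) = (x ⊔ᵈ x) ⊓ᵈ (x ⊔ᵈ x)

/-- A dBa is pure if each element is `⊓`-idempotent or `⊔`-idempotent. -/
def IsPure (D : Type u) [DBA D] : Prop :=
  ∀ x : D, x ⊓ᵈ x = x ∨ x ⊔ᵈ x = x

/-- The quasi-order `⊑` of a dBa. -/
def SqLe {D : Type u} [DBA D] (x y : D) : Prop :=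
  x ⊓ᵈ y = x ⊓ᵈ x ∧ x ⊔ᵈ y = y ⊔ᵈ y

/-! ### Formulas, sequents, hypersequents -/

/-- Formulas over countably many object variables `obj n` (`p, q, …`) and countably many
property variables `prp n` (`P, Q, …`). -/
inductive Formula : Type
  | obj : ℕ → Formula
  | prp : ℕ → Formula
  | neg : Formula → Formula
  | opp : Formula → Formula
  | meet : Formula → Formula → Formula
  | join : Formula → Formula → Formula
  | top : Formula
  | bot : Formula

instance : DBAOps Formula where
  meet := Formula.meet
  join := Formula.join
  neg := Formula.neg
  opp := Formula.opp
  top := Formula.top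
  bot := Formula.bot

/-- A sequent `φ ⇒ ψ`. -/
structure Sequent : Type where
  lhs : Formula
  rhs : Formula

infix:50 " ⇒ˢ " => Sequent.mk

/-- A hypersequent `φ₁ ⇒ ψ₁ ∣ … ∣ φₙ ⇒ ψₙ`, as the list of its components. -/
abbrev Hypersequent : Type := List Sequent

/-! ### Axioms -/

/-- The axioms of **L**; an axiom `φ ⇔ ψ` stands for both `φ ⇒ ψ` and `ψ ⇒ φ`. -/
inductive LAxiom : Sequent → Prop
  | refl (φ : Formula) : LAxiom (φ ⇒ˢ φ)
  | meet_left (φ ψ : Formula) : LAxiom (φ ⊓ᵈ ψ ⇒ˢ φ)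
  | meet_right (φ ψ : Formula) : LAxiom (φ ⊓ᵈ ψ ⇒ˢ ψ)
  | join_left (φ ψ : Formula) : LAxiom (φ ⇒ˢ φ ⊔ᵈ ψ)
  | join_right (φ ψ : Formula) : LAxiom (ψ ⇒ˢ φ ⊔ᵈ ψ)
  | neg_meet_self (φ : Formula) : LAxiom (¬ᵈ(φ ⊓ᵈ φ) ⇒ˢ ¬ᵈφ)
  | opp_join_self (φ : Formula) : LAxiom (⌟ᵈφ ⇒ˢ ⌟ᵈ(φ ⊔ᵈ φ))
  | meet_neg (φ : Formula) : LAxiom (φ ⊓ᵈ ¬ᵈφ ⇒ˢ ⊥ᵈ)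
  | meet_neg_rev (φ : Formula) : LAxiom (⊥ᵈ ⇒ˢ φ ⊓ᵈ ¬ᵈφ)
  | join_opp (φ : Formula) : LAxiom (⊤ᵈ ⇒ˢ φ ⊔ᵈ ⌟ᵈφ)
  | join_opp_rev (φ : Formula) : LAxiom (φ ⊔ᵈ ⌟ᵈφ ⇒ˢ ⊤ᵈ)
  | neg_neg_meet (φ ψ : Formula) : LAxiom (¬ᵈ(¬ᵈ(φ ⊓ᵈ ψ)) ⇒ˢ φ ⊓ᵈ ψ)
  | neg_neg_meet_rev (φ ψ : Formula) : LAxiom (φ ⊓ᵈ ψ ⇒ˢ ¬ᵈ(¬ᵈ(φ ⊓ᵈ ψ)))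
  | opp_opp_join (φ ψ : Formula) : LAxiom (⌟ᵈ(⌟ᵈ(φ ⊔ᵈ ψ)) ⇒ˢ φ ⊔ᵈ ψ)
  | opp_opp_join_rev (φ ψ : Formula) : LAxiom (φ ⊔ᵈ ψ ⇒ˢ ⌟ᵈ(⌟ᵈ(φ ⊔ᵈ ψ)))
  | meet_join_absorb (φ ψ : Formula) : LAxiom (φ ⊓ᵈ φ ⇒ˢ φ ⊓ᵈ (φ ⊔ᵈ ψ))
  | join_meet_absorb (φ ψ : Formula) : LAxiom (φ ⊔ᵈ (φ ⊓ᵈ ψ) ⇒ˢ φ ⊔ᵈ φ)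
  | meet_vee_distrib (φ ψ θ : Formula) :
      LAxiom (φ ⊓ᵈ (ψ ∨ᵈ θ) ⇒ˢ (φ ⊓ᵈ ψ) ∨ᵈ (φ ⊓ᵈ θ))
  | meet_vee_distrib_rev (φ ψ θ : Formula) :
      LAxiom ((φ ⊓ᵈ ψ) ∨ᵈ (φ ⊓ᵈ θ) ⇒ˢ φ ⊓ᵈ (ψ ∨ᵈ θ))
  | join_wedge_distrib (φ ψ θ : Formula) :
      LAxiom (φ ⊔ᵈ (ψ ∧ᵈ θ) ⇒ˢ (φ ⊔ᵈ ψ) ∧ᵈ (φ ⊔ᵈ θ))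
  | join_wedge_distrib_rev (φ ψ θ : Formula) :
      LAxiom ((φ ⊔ᵈ ψ) ∧ᵈ (φ ⊔ᵈ θ) ⇒ˢ φ ⊔ᵈ (ψ ∧ᵈ θ))
  | join_meet_join (φ : Formula) :
      LAxiom ((φ ⊔ᵈ φ) ⊓ᵈ (φ ⊔ᵈ φ) ⇒ˢ (φ ⊓ᵈ φ) ⊔ᵈ (φ ⊓ᵈ φ))
  | join_meet_join_rev (φ : Formula) :
      LAxiom ((φ ⊓ᵈ φ) ⊔ᵈ (φ ⊓ᵈ φ) ⇒ˢ (φ ⊔ᵈ φ) ⊓ᵈ (φ ⊔ᵈ φ))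

/-- The axioms of **CDBL**: those of **L** together with the further schemes below. -/
inductive CDBLAxiom : Sequent → Prop
  | ofL {s : Sequent} : LAxiom s → CDBLAxiom s
  | meet_idem (φ ψ : Formula) : CDBLAxiom (φ ⊓ᵈ ψ ⇒ˢ (φ ⊓ᵈ ψ) ⊓ᵈ (φ ⊓ᵈ ψ))
  | join_idem (φ ψ : Formula) : CDBLAxiom ((φ ⊔ᵈ ψ) ⊔ᵈ (φ ⊔ᵈ ψ) ⇒ˢ φ ⊔ᵈ ψ)
  | meet_vee_absorb (φ ψ : Formula) : CDBLAxiom (φ ⊓ᵈ φ ⇒ˢ φ ⊓ᵈ (φ ∨ᵈ ψ))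
  | join_wedge_absorb (φ ψ : Formula) : CDBLAxiom (φ ⊔ᵈ (φ ∧ᵈ ψ) ⇒ˢ φ ⊔ᵈ φ)
  | bot_le (φ : Formula) : CDBLAxiom (⊥ᵈ ⇒ˢ φ)
  | le_top (φ : Formula) : CDBLAxiom (φ ⇒ˢ ⊤ᵈ)
  | neg_top : CDBLAxiom (¬ᵈ⊤ᵈ ⇒ˢ ⊥ᵈ)
  | opp_bot : CDBLAxiom (⊤ᵈ ⇒ˢ ⌟ᵈ⊥ᵈ)
  | neg_bot : CDBLAxiom (¬ᵈ⊥ᵈ ⇒ˢ ⊤ᵈ ⊓ᵈ ⊤ᵈ)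
  | neg_bot_rev : CDBLAxiom (⊤ᵈ ⊓ᵈ ⊤ᵈ ⇒ˢ ¬ᵈ⊥ᵈ)
  | opp_top : CDBLAxiom (⌟ᵈ⊤ᵈ ⇒ˢ ⊥ᵈ ⊔ᵈ ⊥ᵈ)
  | opp_top_rev : CDBLAxiom (⊥ᵈ ⊔ᵈ ⊥ᵈ ⇒ˢ ⌟ᵈ⊤ᵈ)

/-- The two axioms for variables: `p ⊓ p ⇔ p` and `P ⊔ P ⇔ P`. -/
inductive VarAxiom : Sequent → Prop
  | obj (n : ℕ) : VarAxiom (Formula.obj n ⊓ᵈ Formula.obj n ⇒ˢ Formula.obj n)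
  | obj_rev (n : ℕ) : VarAxiom (Formula.obj n ⇒ˢ Formula.obj n ⊓ᵈ Formula.obj n)
  | prp (n : ℕ) : VarAxiom (Formula.prp n ⊔ᵈ Formula.prp n ⇒ˢ Formula.prp n)
  | prp_rev (n : ℕ) : VarAxiom (Formula.prp n ⇒ˢ Formula.prp n ⊔ᵈ Formula.prp n)

/-! ### The hypersequent calculi -/

/-- Derivability of hypersequents from the axioms `Ax` by the rules of inference of **PDBL**.
The side hypersequents `B, C, D, …` may be empty. -/
inductive Derivable (Ax : Sequent → Prop) : Hypersequent → Prop
  | ax {s : Sequent} : Ax s → Derivable Ax [s]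
  | meetR (B C : Hypersequent) (φ ψ θ : Formula) :
      Derivable Ax (B ++ [φ ⇒ˢ ψ] ++ C) → Derivable Ax (B ++ [φ ⊓ᵈ θ ⇒ˢ ψ ⊓ᵈ θ] ++ C)
  | meetL (B C : Hypersequent) (φ ψ θ : Formula) :
      Derivable Ax (B ++ [φ ⇒ˢ ψ] ++ C) → Derivable Ax (B ++ [θ ⊓ᵈ φ ⇒ˢ θ ⊓ᵈ ψ] ++ C)
  | neg (B C : Hypersequent) (φ ψ : Formula) :
      Derivable Ax (B ++ [φ ⇒ˢ ψ] ++ C) → Derivable Ax (B ++ [¬ᵈψ ⇒ˢ ¬ᵈφ] ++ C)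
  | joinL (B C : Hypersequent) (φ ψ θ : Formula) :
      Derivable Ax (B ++ [φ ⇒ˢ ψ] ++ C) → Derivable Ax (B ++ [θ ⊔ᵈ φ ⇒ˢ θ ⊔ᵈ ψ] ++ C)
  | joinR (B C : Hypersequent) (φ ψ θ : Formula) :
      Derivable Ax (B ++ [φ ⇒ˢ ψ] ++ C) → Derivable Ax (B ++ [φ ⊔ᵈ θ ⇒ˢ ψ ⊔ᵈ θ] ++ C)
  | opp (B C : Hypersequent) (φ ψ : Formula) :
      Derivable Ax (B ++ [φ ⇒ˢ ψ] ++ C) → Derivable Ax (B ++ [⌟ᵈψ ⇒ˢ ⌟ᵈφ] ++ C)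
  | cut (B C D E : Hypersequent) (φ ψ θ : Formula) :
      Derivable Ax (B ++ [φ ⇒ˢ ψ] ++ C) → Derivable Ax (D ++ [ψ ⇒ˢ θ] ++ E) →
      Derivable Ax (B ++ D ++ [φ ⇒ˢ θ] ++ C ++ E)
  | sp (φ : Formula) : Derivable Ax [φ ⇒ˢ φ ⊓ᵈ φ, φ ⊔ᵈ φ ⇒ˢ φ]
  | sqle (B C D E F G H X : Hypersequent) (φ ψ : Formula) :
      Derivable Ax (B ++ [φ ⊓ᵈ ψ ⇒ˢ φ ⊓ᵈ φ] ++ C) →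
      Derivable Ax (D ++ [φ ⊓ᵈ φ ⇒ˢ φ ⊓ᵈ ψ] ++ E) →
      Derivable Ax (F ++ [φ ⊔ᵈ ψ ⇒ˢ ψ ⊔ᵈ ψ] ++ G) →
      Derivable Ax (H ++ [ψ ⊔ᵈ ψ ⇒ˢ φ ⊔ᵈ ψ] ++ X) →
      Derivable Ax (B ++ D ++ F ++ H ++ [φ ⇒ˢ ψ] ++ C ++ E ++ G ++ X)
  | ec (B C D : Hypersequent) :
      Derivable Ax (B ++ D ++ D ++ C) → Derivable Ax (B ++ D ++ C)
  | ee (B C D E : Hypersequent) :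
      Derivable Ax (B ++ D ++ E ++ C) → Derivable Ax (B ++ E ++ D ++ C)
  | ew (B C : Hypersequent) : Derivable Ax B → Derivable Ax (B ++ C)

/-- Derivability in **PDBL**. -/
def PDBL (H : Hypersequent) : Prop :=
  Derivable (fun s => CDBLAxiom s ∨ VarAxiom s) H

/-- Derivability in **HL**. -/
def HL (H : Hypersequent) : Prop :=
  Derivable (fun s => LAxiom s ∨ VarAxiom s) H

/-! ### Semantics in pure dBas -/

/-- Interpretations of formulas in a dBa: homomorphisms from the algebra of formulas
that send object variables to `⊓`-idempotent and property variables to `⊔`-idempotent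
elements. -/
structure Interpretation (D : Type u) [DBA D] where
  toFun : Formula → D
  map_meet : ∀ φ ψ : Formula, toFun (φ ⊓ᵈ ψ) = toFun φ ⊓ᵈ toFun ψ
  map_join : ∀ φ ψ : Formula, toFun (φ ⊔ᵈ ψ) = toFun φ ⊔ᵈ toFun ψ
  map_neg : ∀ φ : Formula, toFun (¬ᵈφ) = ¬ᵈ(toFun φ)
  map_opp : ∀ φ : Formula, toFun (⌟ᵈφ) = ⌟ᵈ(toFun φ)
  map_top : toFun ⊤ᵈ = ⊤ᵈ
  map_bot : toFun ⊥ᵈ = ⊥ᵈ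
  obj_mem : ∀ n : ℕ, toFun (Formula.obj n) ⊓ᵈ toFun (Formula.obj n) = toFun (Formula.obj n)
  prp_mem : ∀ n : ℕ, toFun (Formula.prp n) ⊔ᵈ toFun (Formula.prp n) = toFun (Formula.prp n)

/-- A hypersequent is satisfied by `h` if one of its components `φ ⇒ ψ` has `h φ ⊑ h ψ`. -/
def Satisfies {D : Type u} [DBA D] (h : Interpretation D) (H : Hypersequent) : Prop :=
  ∃ s ∈ H, SqLe (h.toFun s.lhs) (h.toFun s.rhs)

/-- A hypersequent is true in a dBa if every interpretation satisfies it. -/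
def TrueIn (D : Type u) [DBA D] (H : Hypersequent) : Prop :=
  ∀ h : Interpretation D, Satisfies h H

/-- Validity in the class of all pure dBas (with carrier in `Type u`). -/
def Valid (H : Hypersequent) : Prop :=
  ∀ (D : Type u) [DBA D], IsPure D → TrueIn D H

end PureDBL

/-! The additional axioms of **CDBL** are redundant. Double negation and `¬(φ ⊓ φ) ⇒ ¬φ` make every
meet `⊓`-idempotent, so meets of formulas have the universal property of a greatest lower bound for
left sides that are themselves meets (`ContextLaws.le_meet`). Commutativity, associativity and the
laws for the constants follow, and the `⊔`-half is the same argument for the converse relation. With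
`Γ = ∅` in `DerivableModulo` this gives the equivalence of the calculi.

Soundness is an induction on derivations. Purity validates (Sp), and the rule (⊑) is sound because
`⊑`, only a quasi-order in general, is antisymmetric on meets and on joins.

For completeness, the components of an underivable hypersequent form a refutable set, which Zorn's
lemma enlarges to a maximal one, `Γ`. Admitting members of `Γ` as side components gives a relation
on formulas whose Lindenbaum quotient is a dBa, and (Sp) makes it pure. By maximality a sequent is
derivable modulo `Γ` exactly when it lies outside `Γ`. By (⊑), a sequent satisfied by the canonical
interpretation is derivable modulo `Γ`, so the canonical interpretation refutes the given
hypersequent. -/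

namespace PureDBL

/-! ### The laws of one half of the signature -/

/-- The laws on `⊓`, `¬`, `⊤`, `⊥` common to the calculi, for a relation `le` on an algebra.
Applied to the converse relation they become the laws on `⊔`, `⌟`, `⊥`, `⊤`. -/
structure ContextLaws {D : Type*} (le : D → D → Prop) (meet : D → D → D) (neg : D → D)
    (top bot : D) : Prop where
  trans : ∀ {a b c}, le a b → le b c → le a c
  meet_left : ∀ a b, le (meet a b) a
  meet_right : ∀ a b, le (meet a b) b
  meet_mono : ∀ {a b c d}, le a b → le c d → le (meet a c) (meet b d)
  neg_anti : ∀ {a b}, le a b → le (neg b) (neg a)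
  neg_meet_self : ∀ a, le (neg (meet a a)) (neg a)
  meet_neg : ∀ a, le (meet a (neg a)) bot
  meet_neg_rev : ∀ a, le bot (meet a (neg a))
  neg_neg_meet : ∀ a b, le (neg (neg (meet a b))) (meet a b)
  neg_neg_meet_rev : ∀ a b, le (meet a b) (neg (neg (meet a b)))
  le_top : ∀ a, le a top

namespace ContextLaws

variable {D : Type*} {le : D → D → Prop} {meet : D → D → D} {neg : D → D} {top bot : D}

theorem bot_le (h : ContextLaws le meet neg top bot) (a : D) : le bot a :=
  h.trans (h.meet_neg_rev a) (h.meet_left _ _)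

theorem neg_meet_self_rev (h : ContextLaws le meet neg top bot) (a : D) :
    le (neg a) (neg (meet a a)) :=
  h.neg_anti (h.meet_left _ _)

/-- With `c = a ⊓ b`, one has `c ≤ ¬¬c ≤ ¬¬(c ⊓ c) ≤ c ⊓ c`, the middle step negating `¬(c ⊓ c) ≤
¬c`. -/
theorem meet_idem (h : ContextLaws le meet neg top bot) (a b : D) :
    le (meet a b) (meet (meet a b) (meet a b)) :=
  h.trans (h.neg_neg_meet_rev a b)
    (h.trans (h.neg_anti (h.neg_meet_self _)) (h.neg_neg_meet _ _))

theorem meet_self_le_neg_neg (h : ContextLaws le meet neg top bot) (a : D) :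
    le (meet a a) (neg (neg a)) :=
  h.trans (h.neg_neg_meet_rev a a) (h.neg_anti (h.neg_meet_self_rev a))

theorem neg_neg_le_meet_self (h : ContextLaws le meet neg top bot) (a : D) :
    le (neg (neg a)) (meet a a) :=
  h.trans (h.neg_anti (h.neg_meet_self a)) (h.neg_neg_meet a a)

theorem neg_idem (h : ContextLaws le meet neg top bot) (a : D) :
    le (neg a) (meet (neg a) (neg a)) :=
  h.trans (h.neg_meet_self_rev a)
    (h.trans (h.neg_anti (h.neg_neg_le_meet_self a)) (h.neg_neg_le_meet_self (neg a)))

/-- In general `a ≤ a ⊓ a` fails, so the universal property of the meet is available only when the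
left side is idempotent; meets are. -/
theorem le_meet (h : ContextLaws le meet neg top bot) {a b x y : D}
    (hx : le (meet a b) x) (hy : le (meet a b) y) : le (meet a b) (meet x y) :=
  h.trans (h.meet_idem a b) (h.meet_mono hx hy)

theorem meet_comm (h : ContextLaws le meet neg top bot) (a b : D) :
    le (meet a b) (meet b a) :=
  h.le_meet (h.meet_right _ _) (h.meet_left _ _)

theorem meet_assoc (h : ContextLaws le meet neg top bot) (a b c : D) :
    le (meet a (meet b c)) (meet (meet a b) c) :=
  have hbc := h.meet_right a (meet b c)
  h.le_meet (h.le_meet (h.meet_left _ _) (h.trans hbc (h.meet_left _ _)))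
    (h.trans hbc (h.meet_right _ _))

theorem meet_assoc_rev (h : ContextLaws le meet neg top bot) (a b c : D) :
    le (meet (meet a b) c) (meet a (meet b c)) :=
  have hab := h.meet_left (meet a b) c
  h.le_meet (h.trans hab (h.meet_left _ _))
    (h.le_meet (h.trans hab (h.meet_right _ _)) (h.meet_right _ _))

theorem meet_idem_left (h : ContextLaws le meet neg top bot) (a b : D) :
    le (meet (meet a a) b) (meet a b) :=
  h.le_meet (h.trans (h.meet_left _ _) (h.meet_left _ _)) (h.meet_right _ _)

theorem meet_idem_left_rev (h : ContextLaws le meet neg top bot) (a b : D) :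
    le (meet a b) (meet (meet a a) b) :=
  h.le_meet (h.le_meet (h.meet_left _ _) (h.meet_left _ _)) (h.meet_right _ _)

theorem meet_le_meet_self (h : ContextLaws le meet neg top bot) (a b : D) :
    le (meet a b) (meet a a) :=
  h.le_meet (h.meet_left _ _) (h.meet_left _ _)

theorem meet_vee_absorb (h : ContextLaws le meet neg top bot) (a b : D) :
    le (meet a a) (meet a (neg (meet (neg a) (neg b)))) :=
  h.le_meet (h.meet_left _ _)
    (h.trans (h.meet_self_le_neg_neg a) (h.neg_anti (h.meet_left _ _)))

theorem neg_top (h : ContextLaws le meet neg top bot) : le (neg top) bot :=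
  h.trans (h.neg_idem top)
    (h.trans (h.meet_mono (h.le_top _) (h.trans (h.neg_idem top) (h.meet_left _ _)))
      (h.meet_neg top))

theorem neg_bot (h : ContextLaws le meet neg top bot) : le (neg bot) (meet top top) :=
  h.trans (h.neg_idem bot) (h.meet_mono (h.le_top _) (h.le_top _))

theorem neg_bot_rev (h : ContextLaws le meet neg top bot) : le (meet top top) (neg bot) :=
  h.trans (h.meet_self_le_neg_neg top) (h.neg_anti (h.bot_le _))

end ContextLaws

/-! ### Sequent orders and their Lindenbaum algebras -/

/-- Relations on formulas that contain the axioms of **L** and are closed under the rules of the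
calculi with one or two premises. -/
structure SequentOrder (le : Formula → Formula → Prop) : Prop where
  ax : ∀ {φ ψ}, LAxiom (φ ⇒ˢ ψ) → le φ ψ
  trans : ∀ {φ ψ θ}, le φ ψ → le ψ θ → le φ θ
  meetR : ∀ {φ ψ} θ, le φ ψ → le (φ ⊓ᵈ θ) (ψ ⊓ᵈ θ)
  meetL : ∀ {φ ψ} θ, le φ ψ → le (θ ⊓ᵈ φ) (θ ⊓ᵈ ψ)
  joinR : ∀ {φ ψ} θ, le φ ψ → le (φ ⊔ᵈ θ) (ψ ⊔ᵈ θ)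
  joinL : ∀ {φ ψ} θ, le φ ψ → le (θ ⊔ᵈ φ) (θ ⊔ᵈ ψ)
  neg : ∀ {φ ψ}, le φ ψ → le (¬ᵈψ) (¬ᵈφ)
  opp : ∀ {φ ψ}, le φ ψ → le (⌟ᵈψ) (⌟ᵈφ)

namespace SequentOrder

variable {le : Formula → Formula → Prop}

theorem meetLaws (h : SequentOrder le) :
    ContextLaws le (fun φ ψ => φ ⊓ᵈ ψ) (fun φ => ¬ᵈφ) ⊤ᵈ ⊥ᵈ where
  trans := h.trans
  meet_left _ _ := h.ax (.meet_left _ _)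
  meet_right _ _ := h.ax (.meet_right _ _)
  meet_mono h₁ h₂ := h.trans (h.meetR _ h₁) (h.meetL _ h₂)
  neg_anti := h.neg
  neg_meet_self _ := h.ax (.neg_meet_self _)
  meet_neg _ := h.ax (.meet_neg _)
  meet_neg_rev _ := h.ax (.meet_neg_rev _)
  neg_neg_meet _ _ := h.ax (.neg_neg_meet _ _)
  neg_neg_meet_rev _ _ := h.ax (.neg_neg_meet_rev _ _)
  -- The one law of the `⊓`-half that needs the `⊔`-half: `φ ⇒ φ ⊔ ⌟φ ⇒ ⊤`.
  le_top φ := h.trans (h.ax (.join_left φ (⌟ᵈφ))) (h.ax (.join_opp_rev φ))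

theorem joinLaws (h : SequentOrder le) :
    ContextLaws (fun φ ψ => le ψ φ) (fun φ ψ => φ ⊔ᵈ ψ) (fun φ => ⌟ᵈφ) ⊥ᵈ ⊤ᵈ where
  trans h₁ h₂ := h.trans h₂ h₁
  meet_left _ _ := h.ax (.join_left _ _)
  meet_right _ _ := h.ax (.join_right _ _)
  meet_mono h₁ h₂ := h.trans (h.joinR _ h₁) (h.joinL _ h₂)
  neg_anti := h.opp
  neg_meet_self _ := h.ax (.opp_join_self _)
  meet_neg _ := h.ax (.join_opp _)
  meet_neg_rev _ := h.ax (.join_opp_rev _)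
  neg_neg_meet _ _ := h.ax (.opp_opp_join_rev _ _)
  neg_neg_meet_rev _ _ := h.ax (.opp_opp_join _ _)
  le_top φ := h.meetLaws.bot_le φ

theorem of_CDBLAxiom (h : SequentOrder le) {s : Sequent} (hs : CDBLAxiom s) :
    le s.lhs s.rhs := by
  cases hs with
  | ofL hs => exact h.ax hs
  | meet_idem φ ψ => exact h.meetLaws.meet_idem φ ψ
  | join_idem φ ψ => exact h.joinLaws.meet_idem φ ψ
  | meet_vee_absorb φ ψ => exact h.meetLaws.meet_vee_absorb φ ψ
  | join_wedge_absorb φ ψ => exact h.joinLaws.meet_vee_absorb φ ψ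
  | bot_le φ => exact h.meetLaws.bot_le φ
  | le_top φ => exact h.meetLaws.le_top φ
  | neg_top => exact h.meetLaws.neg_top
  | opp_bot => exact h.joinLaws.neg_top
  | neg_bot => exact h.meetLaws.neg_bot
  | neg_bot_rev => exact h.meetLaws.neg_bot_rev
  | opp_top => exact h.joinLaws.neg_bot_rev
  | opp_top_rev => exact h.joinLaws.neg_bot

/-- The setoid of mutual `le`-inequality, on a copy of the formulas in an arbitrary universe. -/
def setoid (h : SequentOrder le) : Setoid (ULift.{u} Formula) where
  r a b := le a.down b.down ∧ le b.down a.down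
  iseqv :=
    { refl := fun _ => ⟨h.ax (.refl _), h.ax (.refl _)⟩
      symm := fun e => ⟨e.2, e.1⟩
      trans := fun e f => ⟨h.trans e.1 f.1, h.trans f.2 e.2⟩ }

/-- The Lindenbaum algebra of `le`. -/
abbrev Lindenbaum (h : SequentOrder le) : Type u := Quotient h.setoid.{u}

/-- The class of a formula in the Lindenbaum algebra. -/
def toLindenbaum (h : SequentOrder le) (φ : Formula) : Lindenbaum.{u} h := Quotient.mk _ ⟨φ⟩

theorem toLindenbaum_eq (h : SequentOrder le) {φ ψ : Formula} :
    h.toLindenbaum.{u} φ = h.toLindenbaum ψ ↔ le φ ψ ∧ le ψ φ :=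
  ⟨fun e => Quotient.exact e, fun e => Quotient.sound (s := h.setoid) e⟩

theorem toLindenbaum_surjective (h : SequentOrder le) (x : Lindenbaum.{u} h) :
    ∃ φ, h.toLindenbaum φ = x :=
  Quotient.inductionOn x fun a => ⟨a.down, rfl⟩

instance lindenbaumOps (h : SequentOrder le) : DBAOps (Lindenbaum.{u} h) where
  meet := Quotient.map₂ (fun a b => ⟨a.down ⊓ᵈ b.down⟩) fun _ _ e _ _ f =>
    ⟨h.meetLaws.meet_mono e.1 f.1, h.meetLaws.meet_mono e.2 f.2⟩
  join := Quotient.map₂ (fun a b => ⟨a.down ⊔ᵈ b.down⟩) fun _ _ e _ _ f =>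
    ⟨h.joinLaws.meet_mono e.1 f.1, h.joinLaws.meet_mono e.2 f.2⟩
  neg := Quotient.map (fun a => ⟨¬ᵈa.down⟩) fun _ _ e => ⟨h.neg e.2, h.neg e.1⟩
  opp := Quotient.map (fun a => ⟨⌟ᵈa.down⟩) fun _ _ e => ⟨h.opp e.2, h.opp e.1⟩
  top := h.toLindenbaum ⊤ᵈ
  bot := h.toLindenbaum ⊥ᵈ

instance lindenbaumDBA (h : SequentOrder le) : DBA (Lindenbaum.{u} h) where
  meet_idem_left := by
    rintro ⟨x⟩ ⟨y⟩
    exact Quotient.sound (s := h.setoid)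
      ⟨h.meetLaws.meet_idem_left _ _, h.meetLaws.meet_idem_left_rev _ _⟩
  join_idem_left := by
    rintro ⟨x⟩ ⟨y⟩
    exact Quotient.sound (s := h.setoid)
      ⟨h.joinLaws.meet_idem_left_rev _ _, h.joinLaws.meet_idem_left _ _⟩
  meet_comm := by
    rintro ⟨x⟩ ⟨y⟩
    exact Quotient.sound (s := h.setoid)
      ⟨h.meetLaws.meet_comm _ _, h.meetLaws.meet_comm _ _⟩
  join_comm := by
    rintro ⟨x⟩ ⟨y⟩
    exact Quotient.sound (s := h.setoid)
      ⟨h.joinLaws.meet_comm _ _, h.joinLaws.meet_comm _ _⟩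
  neg_meet_self := by
    rintro ⟨x⟩
    exact Quotient.sound (s := h.setoid)
      ⟨h.meetLaws.neg_meet_self _, h.meetLaws.neg_meet_self_rev _⟩
  opp_join_self := by
    rintro ⟨x⟩
    exact Quotient.sound (s := h.setoid)
      ⟨h.joinLaws.neg_meet_self_rev _, h.joinLaws.neg_meet_self _⟩
  meet_join_absorb := by
    rintro ⟨x⟩ ⟨y⟩
    exact Quotient.sound (s := h.setoid)
      ⟨h.meetLaws.meet_le_meet_self _ _, h.ax (.meet_join_absorb _ _)⟩
  join_meet_absorb := by
    rintro ⟨x⟩ ⟨y⟩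
    exact Quotient.sound (s := h.setoid)
      ⟨h.ax (.join_meet_absorb _ _), h.joinLaws.meet_le_meet_self _ _⟩
  meet_vee_distrib := by
    rintro ⟨x⟩ ⟨y⟩ ⟨z⟩
    exact Quotient.sound (s := h.setoid)
      ⟨h.ax (.meet_vee_distrib _ _ _), h.ax (.meet_vee_distrib_rev _ _ _)⟩
  join_wedge_distrib := by
    rintro ⟨x⟩ ⟨y⟩ ⟨z⟩
    exact Quotient.sound (s := h.setoid)
      ⟨h.ax (.join_wedge_distrib _ _ _), h.ax (.join_wedge_distrib_rev _ _ _)⟩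
  meet_vee_absorb := by
    rintro ⟨x⟩ ⟨y⟩
    exact Quotient.sound (s := h.setoid)
      ⟨h.meetLaws.meet_le_meet_self _ _, h.meetLaws.meet_vee_absorb _ _⟩
  join_wedge_absorb := by
    rintro ⟨x⟩ ⟨y⟩
    exact Quotient.sound (s := h.setoid)
      ⟨h.joinLaws.meet_vee_absorb _ _, h.joinLaws.meet_le_meet_self _ _⟩
  neg_neg_meet := by
    rintro ⟨x⟩ ⟨y⟩
    exact Quotient.sound (s := h.setoid)
      ⟨h.ax (.neg_neg_meet _ _), h.ax (.neg_neg_meet_rev _ _)⟩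
  opp_opp_join := by
    rintro ⟨x⟩ ⟨y⟩
    exact Quotient.sound (s := h.setoid)
      ⟨h.ax (.opp_opp_join _ _), h.ax (.opp_opp_join_rev _ _)⟩
  meet_neg := by
    rintro ⟨x⟩
    exact Quotient.sound (s := h.setoid)
      ⟨h.ax (.meet_neg _), h.ax (.meet_neg_rev _)⟩
  join_opp := by
    rintro ⟨x⟩
    exact Quotient.sound (s := h.setoid)
      ⟨h.ax (.join_opp_rev _), h.ax (.join_opp _)⟩
  neg_top := Quotient.sound (s := h.setoid) ⟨h.meetLaws.neg_top, h.meetLaws.bot_le _⟩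
  opp_bot := Quotient.sound (s := h.setoid) ⟨h.meetLaws.le_top _, h.joinLaws.neg_top⟩
  meet_assoc := by
    rintro ⟨x⟩ ⟨y⟩ ⟨z⟩
    exact Quotient.sound (s := h.setoid)
      ⟨h.meetLaws.meet_assoc _ _ _, h.meetLaws.meet_assoc_rev _ _ _⟩
  join_assoc := by
    rintro ⟨x⟩ ⟨y⟩ ⟨z⟩
    exact Quotient.sound (s := h.setoid)
      ⟨h.joinLaws.meet_assoc_rev _ _ _, h.joinLaws.meet_assoc _ _ _⟩
  neg_bot := Quotient.sound (s := h.setoid) ⟨h.meetLaws.neg_bot, h.meetLaws.neg_bot_rev⟩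
  opp_top := Quotient.sound (s := h.setoid) ⟨h.joinLaws.neg_bot_rev, h.joinLaws.neg_bot⟩
  meet_join_meet := by
    rintro ⟨x⟩
    exact Quotient.sound (s := h.setoid)
      ⟨h.ax (.join_meet_join_rev _), h.ax (.join_meet_join _)⟩

/-- The canonical interpretation in the Lindenbaum algebra. -/
def interpretation (h : SequentOrder le)
    (hv : ∀ {φ ψ}, VarAxiom (φ ⇒ˢ ψ) → le φ ψ) : Interpretation (Lindenbaum.{u} h) where
  toFun := h.toLindenbaum
  map_meet _ _ := rfl
  map_join _ _ := rfl
  map_neg _ := rfl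
  map_opp _ := rfl
  map_top := rfl
  map_bot := rfl
  obj_mem n := h.toLindenbaum_eq.2 ⟨hv (.obj n), hv (.obj_rev n)⟩
  prp_mem n := h.toLindenbaum_eq.2 ⟨hv (.prp n), hv (.prp_rev n)⟩

/-- Each disjunct of `hsp` supplies the half of an idempotency equation that the axioms of **L** do
not. -/
theorem isPure_lindenbaum (h : SequentOrder le)
    (hsp : ∀ φ, le φ (φ ⊓ᵈ φ) ∨ le (φ ⊔ᵈ φ) φ) : IsPure (Lindenbaum.{u} h) := by
  intro x
  obtain ⟨φ, rfl⟩ := h.toLindenbaum_surjective x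
  refine (hsp φ).imp (fun e => ?_) fun e => ?_
  · exact h.toLindenbaum_eq.2 ⟨h.ax (.meet_left _ _), e⟩
  · exact h.toLindenbaum_eq.2 ⟨e, h.ax (.join_left _ _)⟩

end SequentOrder

/-! ### Structural properties of derivability -/

namespace Derivable

variable {Ax Ax' : Sequent → Prop}

theorem of_axioms (hAx : ∀ s, Ax s → Derivable Ax' [s]) {H : Hypersequent}
    (hH : Derivable Ax H) : Derivable Ax' H := by
  induction hH with
  | ax hs => exact hAx _ hs
  | meetR B C φ ψ θ _ ih => exact .meetR B C φ ψ θ ih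
  | meetL B C φ ψ θ _ ih => exact .meetL B C φ ψ θ ih
  | neg B C φ ψ _ ih => exact .neg B C φ ψ ih
  | joinL B C φ ψ θ _ ih => exact .joinL B C φ ψ θ ih
  | joinR B C φ ψ θ _ ih => exact .joinR B C φ ψ θ ih
  | opp B C φ ψ _ ih => exact .opp B C φ ψ ih
  | cut B C D E φ ψ θ _ _ ih₁ ih₂ => exact .cut B C D E φ ψ θ ih₁ ih₂
  | sp φ => exact .sp φ
  | sqle B C D E F G H X φ ψ _ _ _ _ ih₁ ih₂ ih₃ ih₄ =>
    exact .sqle B C D E F G H X φ ψ ih₁ ih₂ ih₃ ih₄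
  | ec B C D _ ih => exact .ec B C D ih
  | ee B C D E _ ih => exact .ee B C D E ih
  | ew B C _ ih => exact .ew B C ih

/-- The external structural rules make order and multiplicity irrelevant: weaken to `H ++ K`, then
absorb each component of `H` into its copy in `K`. -/
theorem of_subset {H K : Hypersequent} (hH : Derivable Ax H) (hHK : H ⊆ K) :
    Derivable Ax K := by
  have contract : ∀ L : Hypersequent, L ⊆ K → Derivable Ax (L ++ K) → Derivable Ax K := by
    intro L
    induction L with
    | nil => exact fun _ h => h
    | cons s L ih =>
      intro hL h
      refine ih (fun t ht => hL (List.mem_cons_of_mem s ht)) ?_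
      obtain ⟨K₁, K₂, rfl⟩ := List.append_of_mem (hL List.mem_cons_self)
      -- Exchange moves the leading `s` next to its copy in `K`, ready for contraction.
      have h₁ := Derivable.ee [] ([s] ++ K₂) [s] (L ++ K₁) (by simpa using h)
      simpa using Derivable.ec (L ++ K₁) K₂ [s] (by simpa using h₁)
  exact contract H hHK (.ew H K hH)

/-- The cut rule with a shared side hypersequent on the left. -/
theorem cut_concat {G : Hypersequent} {φ ψ θ : Formula} (h₁ : Derivable Ax (G ++ [φ ⇒ˢ ψ]))
    (h₂ : Derivable Ax (G ++ [ψ ⇒ˢ θ])) : Derivable Ax (G ++ [φ ⇒ˢ θ]) := by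
  have := Derivable.cut G [] G [] φ ψ θ (by simpa using h₁) (by simpa using h₂)
  exact this.of_subset (by grind)

theorem sqle_concat {G : Hypersequent} {φ ψ : Formula}
    (h₁ : Derivable Ax (G ++ [φ ⊓ᵈ ψ ⇒ˢ φ ⊓ᵈ φ])) (h₂ : Derivable Ax (G ++ [φ ⊓ᵈ φ ⇒ˢ φ ⊓ᵈ ψ]))
    (h₃ : Derivable Ax (G ++ [φ ⊔ᵈ ψ ⇒ˢ ψ ⊔ᵈ ψ])) (h₄ : Derivable Ax (G ++ [ψ ⊔ᵈ ψ ⇒ˢ φ ⊔ᵈ ψ])) :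
    Derivable Ax (G ++ [φ ⇒ˢ ψ]) := by
  have := Derivable.sqle G [] G [] G [] G [] φ ψ (by simpa using h₁) (by simpa using h₂)
    (by simpa using h₃) (by simpa using h₄)
  exact this.of_subset (by grind)

end Derivable

/-! ### Derivability modulo a set of sequents -/

/-- Derivability relative to a set `Γ` of sequents admitted as alternatives. -/
def DerivableModulo (Ax : Sequent → Prop) (Γ : Set Sequent) (φ ψ : Formula) : Prop :=
  ∃ G : Hypersequent, (∀ s ∈ G, s ∈ Γ) ∧ Derivable Ax (G ++ [φ ⇒ˢ ψ])

namespace DerivableModulo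

variable {Ax : Sequent → Prop} {Γ : Set Sequent}

theorem of_derivable {φ ψ : Formula} (h : Derivable Ax [φ ⇒ˢ ψ]) : DerivableModulo Ax Γ φ ψ :=
  ⟨[], by simp, h⟩

/-- Concatenating the side hypersequents gives a shared one, as needed for rules with several
premises. -/
theorem exists_common {φ ψ φ' ψ' : Formula} (h : DerivableModulo Ax Γ φ ψ)
    (h' : DerivableModulo Ax Γ φ' ψ') : ∃ G : Hypersequent, (∀ s ∈ G, s ∈ Γ) ∧
      Derivable Ax (G ++ [φ ⇒ˢ ψ]) ∧ Derivable Ax (G ++ [φ' ⇒ˢ ψ']) := by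
  obtain ⟨G, hG, d⟩ := h
  obtain ⟨G', hG', d'⟩ := h'
  refine ⟨G ++ G', fun s hs => (List.mem_append.1 hs).elim (hG s) (hG' s), ?_, ?_⟩
  · exact d.of_subset (by grind)
  · exact d'.of_subset (by grind)

theorem sequentOrder (hL : ∀ s, LAxiom s → Ax s) :
    SequentOrder (DerivableModulo Ax Γ) where
  ax h := of_derivable (.ax (hL _ h))
  trans h₁ h₂ := by
    obtain ⟨G, hG, d₁, d₂⟩ := exists_common h₁ h₂
    exact ⟨G, hG, d₁.cut_concat d₂⟩
  meetR θ := fun ⟨G, hG, d⟩ =>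
    ⟨G, hG, by simpa using Derivable.meetR G [] _ _ θ (by simpa using d)⟩
  meetL θ := fun ⟨G, hG, d⟩ =>
    ⟨G, hG, by simpa using Derivable.meetL G [] _ _ θ (by simpa using d)⟩
  joinR θ := fun ⟨G, hG, d⟩ =>
    ⟨G, hG, by simpa using Derivable.joinR G [] _ _ θ (by simpa using d)⟩
  joinL θ := fun ⟨G, hG, d⟩ =>
    ⟨G, hG, by simpa using Derivable.joinL G [] _ _ θ (by simpa using d)⟩
  neg := fun ⟨G, hG, d⟩ => ⟨G, hG, by simpa using Derivable.neg G [] _ _ (by simpa using d)⟩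
  opp := fun ⟨G, hG, d⟩ => ⟨G, hG, by simpa using Derivable.opp G [] _ _ (by simpa using d)⟩

theorem of_sqle {φ ψ : Formula}
    (h₁ : DerivableModulo Ax Γ (φ ⊓ᵈ ψ) (φ ⊓ᵈ φ)) (h₂ : DerivableModulo Ax Γ (φ ⊓ᵈ φ) (φ ⊓ᵈ ψ))
    (h₃ : DerivableModulo Ax Γ (φ ⊔ᵈ ψ) (ψ ⊔ᵈ ψ)) (h₄ : DerivableModulo Ax Γ (ψ ⊔ᵈ ψ) (φ ⊔ᵈ ψ)) :
    DerivableModulo Ax Γ φ ψ := by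
  obtain ⟨G, hG, d₁, d₂⟩ := exists_common h₁ h₂
  obtain ⟨G', hG', d₃, d₄⟩ := exists_common h₃ h₄
  refine ⟨G ++ G', fun s hs => (List.mem_append.1 hs).elim (hG s) (hG' s), ?_⟩
  exact .sqle_concat (d₁.of_subset (by grind)) (d₂.of_subset (by grind))
    (d₃.of_subset (by grind)) (d₄.of_subset (by grind))

end DerivableModulo

/-! ### Equivalence of **HL** and **PDBL** -/

theorem PDBL_of_HL {H : Hypersequent} (hH : HL H) : PDBL H :=
  hH.of_axioms fun _ hs => .ax (hs.imp_left .ofL)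

theorem HL_of_PDBL {H : Hypersequent} (hH : PDBL H) : HL H := by
  refine hH.of_axioms fun s hs => hs.elim (fun hs => ?_) fun hs => .ax (.inr hs)
  have hord : SequentOrder (DerivableModulo (fun s => LAxiom s ∨ VarAxiom s) ∅) :=
    DerivableModulo.sequentOrder fun _ => Or.inl
  obtain ⟨G, hG, d⟩ := hord.of_CDBLAxiom hs
  -- No alternatives are admitted by `∅`, so this is plain derivability of the single sequent.
  obtain rfl : G = [] := List.eq_nil_iff_forall_not_mem.2 hG
  exact d

/-! ### Soundness -/

section Soundness

variable {D : Type*} [DBA D]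

instance : DBAOps Dᵒᵈ where
  meet := DBAOps.join (D := D)
  join := DBAOps.meet (D := D)
  neg := DBAOps.opp (D := D)
  opp := DBAOps.neg (D := D)
  top := DBAOps.bot (D := D)
  bot := DBAOps.top (D := D)

/-- The axioms are self-dual, so each fact about `⊓`, `¬` yields its counterpart for `⊔`, `⌟`. -/
instance : DBA Dᵒᵈ where
  meet_idem_left := DBA.join_idem_left (D := D)
  join_idem_left := DBA.meet_idem_left (D := D)
  meet_comm := DBA.join_comm (D := D)
  join_comm := DBA.meet_comm (D := D)
  neg_meet_self := DBA.opp_join_self (D := D)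
  opp_join_self := DBA.neg_meet_self (D := D)
  meet_join_absorb := DBA.join_meet_absorb (D := D)
  join_meet_absorb := DBA.meet_join_absorb (D := D)
  meet_vee_distrib := DBA.join_wedge_distrib (D := D)
  join_wedge_distrib := DBA.meet_vee_distrib (D := D)
  meet_vee_absorb := DBA.join_wedge_absorb (D := D)
  join_wedge_absorb := DBA.meet_vee_absorb (D := D)
  neg_neg_meet := DBA.opp_opp_join (D := D)
  opp_opp_join := DBA.neg_neg_meet (D := D)
  meet_neg := DBA.join_opp (D := D)
  join_opp := DBA.meet_neg (D := D)
  neg_top := DBA.opp_bot (D := D)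
  opp_bot := DBA.neg_top (D := D)
  meet_assoc := DBA.join_assoc (D := D)
  join_assoc := DBA.meet_assoc (D := D)
  neg_bot := DBA.opp_top (D := D)
  opp_top := DBA.neg_bot (D := D)
  meet_join_meet := fun x => (DBA.meet_join_meet (D := D) x).symm

theorem sqLe_refl (x : D) : SqLe x x := ⟨rfl, rfl⟩

theorem sqLe_of_eq {x y : D} (h : x = y) : SqLe x y := h ▸ sqLe_refl x

theorem sqLe_toDual {x y : D} : SqLe (D := Dᵒᵈ) x y ↔ SqLe y x := by
  change x ⊔ᵈ y = x ⊔ᵈ x ∧ x ⊓ᵈ y = y ⊓ᵈ y ↔ y ⊓ᵈ x = y ⊓ᵈ y ∧ y ⊔ᵈ x = x ⊔ᵈ x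
  rw [DBA.meet_comm y x, DBA.join_comm y x, and_comm]

theorem meet_idem (x y : D) : (x ⊓ᵈ y) ⊓ᵈ (x ⊓ᵈ y) = x ⊓ᵈ y := by
  rw [← DBA.neg_neg_meet (x ⊓ᵈ y), DBA.neg_meet_self, DBA.neg_neg_meet]

theorem meet_idem_right (x y : D) : x ⊓ᵈ (y ⊓ᵈ y) = x ⊓ᵈ y := by
  rw [DBA.meet_comm, DBA.meet_idem_left, DBA.meet_comm]

theorem neg_neg (x : D) : ¬ᵈ(¬ᵈx) = x ⊓ᵈ x := by
  rw [← DBA.neg_meet_self x, DBA.neg_neg_meet]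

theorem neg_idem (x : D) : ¬ᵈx ⊓ᵈ ¬ᵈx = ¬ᵈx := by
  rw [← neg_neg (¬ᵈx), neg_neg x, DBA.neg_meet_self]

/-- For a `⊓`-idempotent left side the first half of `⊑` suffices. -/
theorem sqLe_of_meet_eq {x y : D} (h : x ⊓ᵈ y = x) : SqLe x y := by
  refine ⟨?_, ?_⟩
  · have : x ⊓ᵈ x = x := by rw [← h, meet_idem]
    rw [h, this]
  · rw [← h, DBA.join_comm, DBA.meet_comm, DBA.join_meet_absorb]

theorem meet_trans {x y z : D} (h₁ : x ⊓ᵈ y = x ⊓ᵈ x) (h₂ : y ⊓ᵈ z = y ⊓ᵈ y) :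
    x ⊓ᵈ z = x ⊓ᵈ x := by
  rw [← DBA.meet_idem_left x z, ← h₁, ← DBA.meet_assoc, h₂, meet_idem_right]

theorem SqLe.trans {x y z : D} (h₁ : SqLe x y) (h₂ : SqLe y z) : SqLe x z :=
  ⟨meet_trans h₁.1 h₂.1, by
    have := meet_trans (D := Dᵒᵈ) (sqLe_toDual.2 h₂).1 (sqLe_toDual.2 h₁).1
    exact (DBA.join_comm x z).trans this⟩

theorem meet_sqLe_left (x y : D) : SqLe (x ⊓ᵈ y) x :=
  sqLe_of_meet_eq (by rw [DBA.meet_comm, DBA.meet_assoc, DBA.meet_idem_left])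

theorem meet_sqLe_right (x y : D) : SqLe (x ⊓ᵈ y) y :=
  DBA.meet_comm y x ▸ meet_sqLe_left y x

theorem SqLe.meetR {x y : D} (h : SqLe x y) (z : D) : SqLe (x ⊓ᵈ z) (y ⊓ᵈ z) := by
  refine sqLe_of_meet_eq ?_
  calc (x ⊓ᵈ z) ⊓ᵈ (y ⊓ᵈ z) = (x ⊓ᵈ y) ⊓ᵈ (z ⊓ᵈ z) := by
        rw [← DBA.meet_assoc, DBA.meet_assoc z, DBA.meet_comm z y, ← DBA.meet_assoc y,
          DBA.meet_assoc]
    _ = x ⊓ᵈ z := by rw [h.1, meet_idem_right, DBA.meet_idem_left]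

theorem SqLe.meetL {x y : D} (h : SqLe x y) (z : D) : SqLe (z ⊓ᵈ x) (z ⊓ᵈ y) := by
  rw [DBA.meet_comm z x, DBA.meet_comm z y]
  exact h.meetR z

theorem SqLe.neg {x y : D} (h : SqLe x y) : SqLe (¬ᵈy) (¬ᵈx) := by
  -- Since `¬¬` is `⊓`-squaring, the right side is `¬(y ⊓ x) = ¬(x ⊓ x)`; absorption for `∨` then
  -- finishes.
  have key : ¬ᵈx = ¬ᵈy ∨ᵈ ¬ᵈx := by
    rw [vee, neg_neg, neg_neg, DBA.meet_idem_left, meet_idem_right, DBA.meet_comm, h.1,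
      DBA.neg_meet_self]
  refine sqLe_of_meet_eq ?_
  rw [key, DBA.meet_vee_absorb, neg_idem]

theorem sqLe_join_left (x y : D) : SqLe x (x ⊔ᵈ y) :=
  sqLe_toDual.1 (meet_sqLe_left (D := Dᵒᵈ) x y)

theorem sqLe_join_right (x y : D) : SqLe y (x ⊔ᵈ y) :=
  sqLe_toDual.1 (meet_sqLe_right (D := Dᵒᵈ) x y)

theorem SqLe.joinR {x y : D} (h : SqLe x y) (z : D) : SqLe (x ⊔ᵈ z) (y ⊔ᵈ z) :=
  sqLe_toDual.1 (SqLe.meetR (D := Dᵒᵈ) (sqLe_toDual.2 h) z)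

theorem SqLe.joinL {x y : D} (h : SqLe x y) (z : D) : SqLe (z ⊔ᵈ x) (z ⊔ᵈ y) :=
  sqLe_toDual.1 (SqLe.meetL (D := Dᵒᵈ) (sqLe_toDual.2 h) z)

theorem SqLe.opp {x y : D} (h : SqLe x y) : SqLe (⌟ᵈy) (⌟ᵈx) :=
  sqLe_toDual.1 (SqLe.neg (D := Dᵒᵈ) (sqLe_toDual.2 h))

/-- Both elements are `⊓`-idempotent, so each equals their common meet. This turns the premises of
(⊑) into the equations defining `⊑`. -/
theorem meet_eq_meet {a b c d : D} (h₁ : SqLe (a ⊓ᵈ b) (c ⊓ᵈ d))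
    (h₂ : SqLe (c ⊓ᵈ d) (a ⊓ᵈ b)) : a ⊓ᵈ b = c ⊓ᵈ d := by
  rw [← meet_idem a b, ← h₁.1, DBA.meet_comm, h₂.1, meet_idem]

theorem join_eq_join {a b c d : D} (h₁ : SqLe (a ⊔ᵈ b) (c ⊔ᵈ d))
    (h₂ : SqLe (c ⊔ᵈ d) (a ⊔ᵈ b)) : a ⊔ᵈ b = c ⊔ᵈ d :=
  meet_eq_meet (D := Dᵒᵈ) (a := a) (b := b) (c := c) (d := d)
    ((sqLe_toDual (D := D)).2 h₂) ((sqLe_toDual (D := D)).2 h₁)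

namespace Interpretation

variable (h : Interpretation D)

theorem map_vee (φ ψ : Formula) : h.toFun (φ ∨ᵈ ψ) = h.toFun φ ∨ᵈ h.toFun ψ := by
  simp only [vee, h.map_neg, h.map_meet]

theorem map_wedge (φ ψ : Formula) : h.toFun (φ ∧ᵈ ψ) = h.toFun φ ∧ᵈ h.toFun ψ := by
  simp only [wedge, h.map_opp, h.map_join]

theorem sqLe_of_LAxiom {s : Sequent} (hs : LAxiom s) : SqLe (h.toFun s.lhs) (h.toFun s.rhs) := by
  cases hs <;> simp only [h.map_meet, h.map_join, h.map_neg, h.map_opp, h.map_top, h.map_bot,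
    h.map_vee, h.map_wedge]
  case refl => exact sqLe_refl _
  case meet_left => exact meet_sqLe_left _ _
  case meet_right => exact meet_sqLe_right _ _
  case join_left => exact sqLe_join_left _ _
  case join_right => exact sqLe_join_right _ _
  case neg_meet_self => exact sqLe_of_eq (DBA.neg_meet_self _)
  case opp_join_self => exact sqLe_of_eq (DBA.opp_join_self _).symm
  case meet_neg => exact sqLe_of_eq (DBA.meet_neg _)
  case meet_neg_rev => exact sqLe_of_eq (DBA.meet_neg _).symm
  case join_opp => exact sqLe_of_eq (DBA.join_opp _).symm
  case join_opp_rev => exact sqLe_of_eq (DBA.join_opp _)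
  case neg_neg_meet => exact sqLe_of_eq (DBA.neg_neg_meet _ _)
  case neg_neg_meet_rev => exact sqLe_of_eq (DBA.neg_neg_meet _ _).symm
  case opp_opp_join => exact sqLe_of_eq (DBA.opp_opp_join _ _)
  case opp_opp_join_rev => exact sqLe_of_eq (DBA.opp_opp_join _ _).symm
  case meet_join_absorb => exact sqLe_of_eq (DBA.meet_join_absorb _ _).symm
  case join_meet_absorb => exact sqLe_of_eq (DBA.join_meet_absorb _ _)
  case meet_vee_distrib => exact sqLe_of_eq (DBA.meet_vee_distrib _ _ _)
  case meet_vee_distrib_rev => exact sqLe_of_eq (DBA.meet_vee_distrib _ _ _).symm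
  case join_wedge_distrib => exact sqLe_of_eq (DBA.join_wedge_distrib _ _ _)
  case join_wedge_distrib_rev => exact sqLe_of_eq (DBA.join_wedge_distrib _ _ _).symm
  case join_meet_join => exact sqLe_of_eq (DBA.meet_join_meet _).symm
  case join_meet_join_rev => exact sqLe_of_eq (DBA.meet_join_meet _)

theorem sqLe_of_VarAxiom {s : Sequent} (hs : VarAxiom s) :
    SqLe (h.toFun s.lhs) (h.toFun s.rhs) := by
  cases hs <;> simp only [h.map_meet, h.map_join, h.obj_mem, h.prp_mem] <;> exact sqLe_refl _

end Interpretation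

theorem satisfies_append (h : Interpretation D) (H K : Hypersequent) :
    Satisfies h (H ++ K) ↔ Satisfies h H ∨ Satisfies h K := by
  simp only [Satisfies, List.mem_append, or_and_right, exists_or]

theorem satisfies_singleton (h : Interpretation D) (φ ψ : Formula) :
    Satisfies h [φ ⇒ˢ ψ] ↔ SqLe (h.toFun φ) (h.toFun ψ) := by
  simp [Satisfies]

theorem satisfies_of_derivable {Ax : Sequent → Prop} (hD : IsPure D) (h : Interpretation D)
    (hAx : ∀ s, Ax s → SqLe (h.toFun s.lhs) (h.toFun s.rhs)) {H : Hypersequent}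
    (hH : Derivable Ax H) : Satisfies h H := by
  induction hH with
  | ax hs => exact ⟨_, List.mem_singleton_self _, hAx _ hs⟩
  | meetR B C φ ψ θ _ ih =>
    simp only [satisfies_append, satisfies_singleton, h.map_meet] at ih ⊢
    exact ih.imp_left (Or.imp_right fun e => e.meetR _)
  | meetL B C φ ψ θ _ ih =>
    simp only [satisfies_append, satisfies_singleton, h.map_meet] at ih ⊢
    exact ih.imp_left (Or.imp_right fun e => e.meetL _)
  | neg B C φ ψ _ ih =>
    simp only [satisfies_append, satisfies_singleton, h.map_neg] at ih ⊢
    exact ih.imp_left (Or.imp_right fun e => e.neg)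
  | joinL B C φ ψ θ _ ih =>
    simp only [satisfies_append, satisfies_singleton, h.map_join] at ih ⊢
    exact ih.imp_left (Or.imp_right fun e => e.joinL _)
  | joinR B C φ ψ θ _ ih =>
    simp only [satisfies_append, satisfies_singleton, h.map_join] at ih ⊢
    exact ih.imp_left (Or.imp_right fun e => e.joinR _)
  | opp B C φ ψ _ ih =>
    simp only [satisfies_append, satisfies_singleton, h.map_opp] at ih ⊢
    exact ih.imp_left (Or.imp_right fun e => e.opp)
  | cut B C D E φ ψ θ _ _ ih₁ ih₂ =>
    simp only [satisfies_append, satisfies_singleton] at ih₁ ih₂ ⊢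
    have := fun e₁ => SqLe.trans (x := h.toFun φ) (y := h.toFun ψ) (z := h.toFun θ) e₁
    tauto
  | sp φ =>
    rcases hD (h.toFun φ) with e | e
    · exact ⟨φ ⇒ˢ φ ⊓ᵈ φ, by simp, sqLe_of_eq (by rw [h.map_meet, e])⟩
    · exact ⟨φ ⊔ᵈ φ ⇒ˢ φ, by simp, sqLe_of_eq (by rw [h.map_join, e])⟩
  | sqle B C D E F G H X φ ψ _ _ _ _ ih₁ ih₂ ih₃ ih₄ =>
    simp only [satisfies_append, satisfies_singleton, h.map_meet, h.map_join]
      at ih₁ ih₂ ih₃ ih₄ ⊢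
    -- If every side component fails, all four premises must hold at their principal components.
    by_contra hn
    simp only [not_or] at hn
    obtain ⟨⟨⟨⟨⟨⟨⟨⟨hB, hD⟩, hF⟩, hH⟩, hs⟩, hC⟩, hE⟩, hG⟩, hX⟩ := hn
    simp only [hB, hD, hF, hH, hC, hE, hG, hX, false_or, or_false] at ih₁ ih₂ ih₃ ih₄
    exact hs ⟨meet_eq_meet ih₁ ih₂, join_eq_join ih₃ ih₄⟩
  | ec B C D _ ih =>
    simp only [satisfies_append] at ih ⊢
    tauto
  | ee B C D E _ ih =>
    simp only [satisfies_append] at ih ⊢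
    tauto
  | ew B C _ ih => exact (satisfies_append _ _ _).2 (.inl ih)

end Soundness

theorem valid_of_HL {H : Hypersequent} (hH : HL H) : Valid.{u} H := fun _ _ hD h =>
  satisfies_of_derivable hD h (fun _ hs => hs.elim h.sqLe_of_LAxiom h.sqLe_of_VarAxiom) hH

/-! ### Completeness -/

/-- A set of sequents is refutable if no hypersequent with components in it is derivable. -/
def Refutable (Ax : Sequent → Prop) (Γ : Set Sequent) : Prop :=
  ∀ G : Hypersequent, (∀ s ∈ G, s ∈ Γ) → ¬ Derivable Ax G

theorem Refutable.exists_maximal {Ax : Sequent → Prop} {Γ : Set Sequent}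
    (hΓ : Refutable Ax Γ) : ∃ Δ, Γ ⊆ Δ ∧ Maximal (Refutable Ax) Δ := by
  refine zorn_subset_nonempty {Δ | Refutable Ax Δ} (fun c hc hchain hne => ?_) Γ hΓ
  refine ⟨⋃₀ c, fun G hG d => ?_, fun s hs => Set.subset_sUnion_of_mem hs⟩
  -- Refutability has finite character: a hypersequent has finitely many components, so one member
  -- of the chain contains them all.
  obtain ⟨Δ, hΔ, hGΔ⟩ := DirectedOn.exists_mem_subset_of_finite_of_subset_sUnion hne
    hchain.directedOn G.finite_toSet hG
  exact hc hΔ G hGΔ d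

/-- Modulo a maximal refutable set, exactly the sequents outside of it are derivable. -/
theorem derivableModulo_iff_notMem {Ax : Sequent → Prop} {Γ : Set Sequent}
    (hΓ : Maximal (Refutable Ax) Γ) {φ ψ : Formula} :
    DerivableModulo Ax Γ φ ψ ↔ (φ ⇒ˢ ψ) ∉ Γ := by
  classical
  constructor
  · rintro ⟨G, hG, d⟩ hmem
    refine hΓ.prop _ (fun s hs => ?_) d
    rcases List.mem_append.1 hs with hs | hs
    · exact hG s hs
    · rwa [List.mem_singleton.1 hs]
  · intro hmem
    have hins : ¬ Refutable Ax (insert (φ ⇒ˢ ψ) Γ) := fun hr =>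
      hmem (hΓ.le_of_ge hr (Set.subset_insert _ _) (Set.mem_insert _ _))
    simp only [Refutable, not_forall, not_not] at hins
    obtain ⟨G, hG, d⟩ := hins
    -- All occurrences of the added sequent in `G` are merged into the one final component.
    refine ⟨G.filter (· ∈ Γ), fun s hs => by simpa using (List.mem_filter.1 hs).2,
      d.of_subset fun s hs => ?_⟩
    rcases hG s hs with rfl | h
    · simp
    · simp [hs, h]

theorem HL_of_valid {H : Hypersequent} (hH : Valid.{u} H) : HL H := by
  by_contra hn
  have hr : Refutable (fun s => LAxiom s ∨ VarAxiom s) {s | s ∈ H} :=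
    fun G hG d => hn (d.of_subset hG)
  obtain ⟨Γ, hHΓ, hΓ⟩ := hr.exists_maximal
  have hord : SequentOrder (DerivableModulo (fun s => LAxiom s ∨ VarAxiom s) Γ) :=
    DerivableModulo.sequentOrder fun _ => Or.inl
  have hpure : IsPure hord.Lindenbaum.{u} := hord.isPure_lindenbaum fun φ => by
    rw [derivableModulo_iff_notMem hΓ, derivableModulo_iff_notMem hΓ, ← not_and_or]
    rintro ⟨h₁, h₂⟩
    -- Were both components of the (Sp) instance in `Γ`, a derivable hypersequent would lie in a
    -- refutable set.
    exact hΓ.prop _ (by simp [h₁, h₂]) (.sp φ)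
  obtain ⟨s, hs, h₁, h₂⟩ := hH _ hpure
    (hord.interpretation fun hv => DerivableModulo.of_derivable (.ax (.inr hv)))
  have e₁ := hord.toLindenbaum_eq.1 h₁
  have e₂ := hord.toLindenbaum_eq.1 h₂
  -- Equality of classes is mutual derivability modulo `Γ`, so (⊑) puts the satisfied component
  -- outside `Γ`, although `H` lies inside.
  exact (derivableModulo_iff_notMem hΓ).1
    (DerivableModulo.of_sqle e₁.1 e₁.2 e₂.1 e₂.2) (hHΓ hs)

end PureDBL

theorem mainTheorem8 :
    (∀ H : PureDBL.Hypersequent, PureDBL.HL H ↔ PureDBL.PDBL H) ∧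
    (∀ H : PureDBL.Hypersequent, PureDBL.HL H → PureDBL.Valid.{u} H) ∧
    (∀ H : PureDBL.Hypersequent, PureDBL.Valid.{u} H → PureDBL.HL H) :=
  ⟨fun _ => ⟨PureDBL.PDBL_of_HL, PureDBL.HL_of_PDBL⟩, fun _ => PureDBL.valid_of_HL,
    fun _ => PureDBL.HL_of_valid⟩
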